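/- Let $L\ge 1$. For $a>0$, $b\in\mathbb{R}\setminus\{0\}$ and $m\in\mathbb{R}$, the Pearson type III distribution with parameters $(a,b,m)$ is the distribution on $\mathbb{R}$ with density $$f(x;a,b,m)=\frac{|b|}{\Gamma(a)}\,\bigl(b(x-m)\bigr)^{a-1}e^{-b(x-m)}\quad\text{if } b(x-m)>0,\qquad f(x;a,b,m)=0\quad\text{otherwise.}$$ Let $X_1,\dots,X_L$ be independent random variables, $X_i$ following the Pearson type III distribution with parameters $(a_i,b_i,m_i)$, where the $a_i$ are positive integers and either $b_i>0$ for all $i$ or $b_i<0$ for all $i$. Put $SX_L=\sum_{i=1}^L X_i$, $sa_L=\sum_{i=1}^L a_i$ and $sm_L=\sum_{i=1}^L m_i$. 1. If $b_i=b$ for all $i$, then $SX_L$ follows the Pearson type III distribution with parameters $(sa_L,b,sm_L)$. 2. If $b_i\ne b_j$ for all $i\ne j$, then $SX_L$ has the probability density function $$f_{SX_L}(x)=\sum_{i=1}^{L}\sum_{k=1}^{a_i}\Xi_L^0(i,k)\,f(x;k,b_i,sm_L),$$ where, with $e_i(1)<\dots<e_i(L-1)$ denoting the elements of $\{1,\dots,L\}\setminus\{i\}$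 (that is, $e_i(s)=s$ for $s<i$ and $e_i(s)=s+1$ for $s\ge i$), $$\Xi_L^0(i,k)=\sum_{(j_0,\dots,j_{L-1})}(-1)^{sa_L-a_i}\,\frac{\prod_{w=1}^{L}b_w^{a_w}}{b_i^{k}}\prod_{s=1}^{L-1}\frac{(j_{s-1}+a_{e_i(s)}-j_s-1)!}{(a_{e_i(s)}-1)!\,(j_{s-1}-j_s)!}\,(b_i-b_{e_i(s)})^{j_s-j_{s-1}-a_{e_i(s)}},$$ the sum running over all integer chains $a_i=j_0\ge j_1\ge\dots\ge j_{L-2}\ge j_{L-1}=k$ (that is, over $j_1=k,\dots,a_i$, then $j_2=k,\dots,j_1$, and so on up to $j_{L-2}=k,\dots,j_{L-3}$; for $L=2$ there is one term, and for $L=1$ the weight is $1$ if $k=a_1$ and $0$ otherwise). Moreover, in case 2 these weights satisfy, for every $i$, $$\Xi_L^0(i,a_i)=\frac{\prod_{w=1}^{L}b_w^{a_w}}{b_i^{a_i}}\prod_{\substack{j=1\\ j\ne i}}^{L}(b_j-b_i)^{-a_j}$$ and, for $1\le k<a_i$, the recursion $$\Xi_L^0(i,a_i-k)=\frac1k\sum_{j=1}^{k}\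 \sum_{\substack{q=1\\ q\ne i}}^{L}a_q\,b_i^{\,j}\,(b_i-b_q)^{-j}\,\Xi_L^0(i,a_i-k+j).$$ -/

import Mathlib

open MeasureTheory ProbabilityTheory
open scoped Nat

noncomputable section

/-- Density of the Pearson type III distribution with shape `a > 0`, inverse scale `b ≠ 0` and
shift `m`. Its support `0 < b * (x - m)` is `(m, ∞)` if `b > 0` and `(-∞, m)` if `b < 0`. -/
def pearsonPDF (a b m x : ℝ) : ℝ :=
  if 0 < b * (x - m) then
    |b| / Real.Gamma a * (b * (x - m)) ^ (a - 1) * Real.exp (-(b * (x - m)))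
  else 0

/-- The real random variable `X` has the probability density function `f` (with respect to
Lebesgue measure). As `f` is required to be nonnegative, `ENNReal.ofReal` loses nothing. -/
def HasRealPDF {Ω : Type*} [MeasurableSpace Ω] (X : Ω → ℝ) (f : ℝ → ℝ) (P : Measure Ω) : Prop :=
  Measurable f ∧ (∀ x, 0 ≤ f x) ∧
    HasLaw X (volume.withDensity fun x => ENNReal.ofReal (f x)) P

/-- `X` follows the Pearson type III distribution with parameters `(a, b, m)`. -/
def IsPearson {Ω : Type*} [MeasurableSpace Ω] (X : Ω → ℝ) (a b m : ℝ) (P : Measure Ω) : Prop :=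
  0 < a ∧ b ≠ 0 ∧ HasRealPDF X (pearsonPDF a b m) P

/-- The index set of the nested sum over `j₁, …, j_{L-2}` with `L = n + 1`: all chains
`A = j₀ ≥ j₁ ≥ ⋯ ≥ j_{L-2} ≥ j_{L-1} = k`, whose two end points are fixed. For `L = 2` there is
just the chain `(A, k)` (if `k ≤ A`), and for `L = 1` the chain exists only if `k = A`. -/
def chains (n A k : ℕ) : Finset (Fin (n + 1) → ℕ) :=
  open Classical in
  (Fintype.piFinset fun _ => Finset.Icc k A).filter
    fun j => Antitone j ∧ j 0 = A ∧ j (Fin.last n) = k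

/-- The weight `Ξ_L^0(i, k)` with `L = n + 1`, as a nested sum over the chains
`a_i = j₀ ≥ j₁ ≥ ⋯ ≥ j_{L-1} = k`. The index `i.succAbove s` runs over the indices other than `i`
in increasing order, i.e. it is `s + U(s - i)` with the Heaviside step `U`, `U(0) = 1`. -/
def Xi0 {n : ℕ} (a : Fin (n + 1) → ℕ) (b : Fin (n + 1) → ℝ) (i : Fin (n + 1)) (k : ℕ) : ℝ :=
  ∑ j ∈ chains n (a i) k,
    (-1 : ℝ) ^ ((∑ q, a q) - a i) * ((∏ w, b w ^ a w) / b i ^ k) *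
      ∏ s : Fin n,
        (((j s.castSucc + a (i.succAbove s) - j s.succ - 1)! : ℕ) : ℝ) /
            ((((a (i.succAbove s) - 1)! : ℕ) : ℝ) * (((j s.castSucc - j s.succ)! : ℕ) : ℝ)) *
          (b i - b (i.succAbove s)) ^
            ((j s.succ : ℤ) - (j s.castSucc : ℤ) - (a (i.succAbove s) : ℤ))

end

/-! Everything is read off from characteristic functions. A Pearson variable with integer shape has
transform `e^{itm} (b / (b - it))^a` (`integral_cexp_mul_pearsonPDF`), so by independence the sum
has the product of these. For equal `b` the product is again of this form.

For distinct `b`, the product is split into partial fractions in `z = it`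
(`prod_inv_pow_eq_sum_cofactorSeries`). With the local variable `u = b_i - z`, the coefficient of
`u^{-k}` is the Taylor coefficient of order `a_i - k` of the cofactor `∏_{q ≠ i} (u + b_q -
b_i)^{-a_q}`. A chain `j` records how this order is distributed over the factors of a Cauchy
product, which identifies the coefficient with `Xi0` up to normalisation
(`Xi0_eq_coeff_cofactorSeries`). The closed form at `k = a_i` is the constant term, and the
recursion is the logarithmic derivative of the cofactor.

The weights may be negative, so the candidate density is a priori signed;
`eq_withDensity_of_charFun_eq` and `HasRealPDF.of_charFun_eq` handle uniqueness and positivity. -/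

/-! ### Chains and Cauchy products -/

theorem mem_chains {n A k : ℕ} {j : Fin (n + 1) → ℕ} :
    j ∈ chains n A k ↔ Antitone j ∧ j 0 = A ∧ j (Fin.last n) = k := by
  simp only [chains, Finset.mem_filter, Fintype.mem_piFinset, Finset.mem_Icc, and_iff_right_iff_imp]
  rintro ⟨hj, rfl, rfl⟩ s
  exact ⟨hj (Fin.le_last s), hj (Fin.zero_le s)⟩

theorem cons_mem_chains {n A B k : ℕ} {j : Fin (n + 1) → ℕ} (hj : j ∈ chains n B k)
    (hBA : B ≤ A) : (Fin.cons A j : Fin (n + 2) → ℕ) ∈ chains (n + 1) A k := by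
  obtain ⟨h1, rfl, rfl⟩ := mem_chains.1 hj
  refine mem_chains.2 ⟨Fin.antitone_iff_succ_le.2 fun s => ?_, rfl, ?_⟩
  · refine Fin.cases ?_ (fun s => ?_) s
    · simpa using hBA
    · simpa [← Fin.succ_castSucc] using h1 s.castSucc_le_succ
  · rw [← Fin.succ_last, Fin.cons_succ]

theorem tail_mem_chains {n A k : ℕ} {j : Fin (n + 2) → ℕ} (hj : j ∈ chains (n + 1) A k) :
    Fin.tail j ∈ chains n (j 1) k := by
  obtain ⟨h1, rfl, rfl⟩ := mem_chains.1 hj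
  exact mem_chains.2 ⟨fun s t hst => h1 (Fin.succ_le_succ_iff.2 hst), rfl, rfl⟩

/-- Summing over the first step of a chain. -/
theorem sum_chains_succ {M : Type*} [AddCommMonoid M] (n A k : ℕ) (F : (Fin (n + 2) → ℕ) → M) :
    ∑ j ∈ chains (n + 1) A k, F j =
      ∑ B ∈ Finset.Icc k A, ∑ j ∈ chains n B k, F (Fin.cons A j) := by
  rw [Finset.sum_sigma']
  refine Finset.sum_bij' (fun j _ => ⟨j 1, Fin.tail j⟩) (fun p _ => Fin.cons A p.2) ?_ ?_ ?_ ?_ ?_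
  · intro j hj
    have h := mem_chains.1 hj
    refine Finset.mem_sigma.2 ⟨Finset.mem_Icc.2 ⟨?_, ?_⟩, tail_mem_chains hj⟩
    · exact h.2.2.symm.le.trans (h.1 (Fin.le_last 1))
    · exact (h.1 (Fin.zero_le 1)).trans h.2.1.le
  · rintro ⟨B, j⟩ hp
    obtain ⟨hB, hj⟩ := Finset.mem_sigma.1 hp
    exact cons_mem_chains hj (Finset.mem_Icc.1 hB).2
  · intro j hj
    obtain ⟨-, rfl, -⟩ := mem_chains.1 hj
    exact Fin.cons_self_tail j
  · rintro ⟨B, j⟩ hp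
    obtain ⟨hB, hj⟩ := Finset.mem_sigma.1 hp
    obtain ⟨-, h, -⟩ := mem_chains.1 hj
    simp only at h
    subst h
    rfl
  · intro j hj
    obtain ⟨-, rfl, -⟩ := mem_chains.1 hj
    exact congrArg F (Fin.cons_self_tail j).symm

/-- Sums over chains compute the coefficients of a product of power series. -/
theorem sum_chains_prod_coeff {R : Type*} [CommSemiring R] {n A k : ℕ} (hk : k ≤ A)
    (f : Fin n → PowerSeries R) :
    ∑ j ∈ chains n A k, ∏ s, PowerSeries.coeff (j s.castSucc - j s.succ) (f s) =
      PowerSeries.coeff (A - k) (∏ s, f s) := by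
  induction n generalizing A with
  | zero =>
    rcases hk.eq_or_lt with rfl | hlt
    · have : chains 0 k k = {fun _ => k} := by
        ext j
        rw [mem_chains, Finset.mem_singleton]
        constructor
        · rintro ⟨-, h, -⟩
          ext s
          rw [Fin.fin_one_eq_zero s, h]
        · rintro rfl
          exact ⟨antitone_const, rfl, rfl⟩
      simp [this]
    · have : chains 0 A k = ∅ := by
        refine Finset.eq_empty_of_forall_notMem fun j hj => ?_
        obtain ⟨-, rfl, h⟩ := mem_chains.1 hj
        exact hlt.ne' h
      simp [this, PowerSeries.coeff_one, (Nat.sub_pos_of_lt hlt).ne']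
  | succ n ih =>
    rw [sum_chains_succ, Fin.prod_univ_succ, PowerSeries.coeff_mul,
      Finset.Nat.sum_antidiagonal_eq_sum_range_succ
        (fun p q => PowerSeries.coeff p (f 0) * PowerSeries.coeff q (∏ s : Fin n, f s.succ))]
    -- A first step from `A` down to `B` takes order `A - B` from `f 0` and leaves `B - k` for the
    -- other factors.
    refine Finset.sum_nbij' (fun B => A - B) (fun r => A - r) ?_ ?_ ?_ ?_ ?_
    · intro B hB
      simp only [Finset.mem_Icc, Finset.mem_range] at hB ⊢
      omega
    · intro r hr
      simp only [Finset.mem_Icc, Finset.mem_range] at hr ⊢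
      omega
    · intro B hB
      simp only [Finset.mem_Icc] at hB
      omega
    · intro r hr
      simp only [Finset.mem_range] at hr
      omega
    · intro B hB
      rw [Finset.mem_Icc] at hB
      have hsub : A - k - (A - B) = B - k := by omega
      rw [hsub, ← ih hB.1 (fun s => f s.succ), Finset.mul_sum]
      refine Finset.sum_congr rfl fun j hj => ?_
      obtain ⟨-, h, -⟩ := mem_chains.1 hj
      rw [Fin.prod_univ_succ]
      simp [h]

/-! ### Power series of `1 / (X - c)` and its powers -/

section PoleSeries

variable {K : Type*} [Field K]

/-- The power series expansion of `1 / (X - c)` at `0`. -/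
noncomputable def poleSeries (c : K) : PowerSeries K :=
  PowerSeries.mk fun r => -c⁻¹ ^ (r + 1)

theorem poleSeries_mul {c : K} (hc : c ≠ 0) :
    poleSeries c * (PowerSeries.X - PowerSeries.C c) = 1 := by
  ext r
  rw [mul_sub, map_sub, PowerSeries.coeff_mul_C]
  cases r with
  | zero => simp [poleSeries, hc]
  | succ r =>
    rw [PowerSeries.coeff_succ_mul_X]
    simp only [poleSeries, PowerSeries.coeff_mk, PowerSeries.coeff_one, Nat.succ_ne_zero, if_false]
    rw [pow_succ _ (r + 1), neg_mul, inv_mul_cancel_right₀ hc, sub_self]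

theorem derivative_poleSeries {c : K} (hc : c ≠ 0) :
    PowerSeries.derivative K (poleSeries c) = -poleSeries c ^ 2 := by
  have h := congrArg (PowerSeries.derivative K) (poleSeries_mul hc)
  rw [Derivation.leibniz, map_sub, PowerSeries.derivative_X, PowerSeries.derivative_C,
    PowerSeries.derivative_one, smul_eq_mul, smul_eq_mul] at h
  linear_combination poleSeries c * h - PowerSeries.derivative K (poleSeries c) * poleSeries_mul hc

/-- The series is `-c⁻¹` times a rescaled geometric series, whose powers have binomial coefficients.
-/
theorem coeff_poleSeries_pow {c : K} [CharZero K] {a : ℕ} (ha : 0 < a) (r : ℕ) :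
    PowerSeries.coeff r (poleSeries c ^ a) =
      (-1) ^ a * ((((r + a - 1)! : ℕ) : K) / (((a - 1)! : ℕ) * (r ! : ℕ)) * c⁻¹ ^ (r + a)) := by
  obtain ⟨d, rfl⟩ : ∃ d, a = d + 1 := ⟨a - 1, by omega⟩
  have h : poleSeries c =
      PowerSeries.C (-c⁻¹) * PowerSeries.rescale c⁻¹ (PowerSeries.mk 1) := by
    ext r
    simp [poleSeries, PowerSeries.coeff_rescale, pow_succ']
  rw [h, mul_pow, ← map_pow, ← map_pow, PowerSeries.coeff_C_mul, PowerSeries.coeff_rescale,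
    PowerSeries.mk_one_pow_eq_mk_choose_add, PowerSeries.coeff_mk,
    Nat.cast_choose K (Nat.le_add_right d r), neg_pow, Nat.add_sub_cancel_left,
    Nat.add_sub_cancel, show r + (d + 1) - 1 = d + r by omega]
  ring

variable {ι : Type*}

theorem derivative_prod_poleSeries_pow (s : Finset ι) (a : ι → ℕ) (c : ι → K)
    (hc : ∀ q ∈ s, c q ≠ 0) :
    PowerSeries.derivative K (∏ q ∈ s, poleSeries (c q) ^ a q) =
      -((∑ q ∈ s, PowerSeries.C (a q : K) * poleSeries (c q)) *
        ∏ q ∈ s, poleSeries (c q) ^ a q) := by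
  classical
  induction s using Finset.induction_on with
  | empty => simp
  | insert q s hq ih =>
    have hpow : PowerSeries.derivative K (poleSeries (c q) ^ a q) =
        -(PowerSeries.C (a q : K) * poleSeries (c q) ^ (a q + 1)) := by
      rw [PowerSeries.derivative_pow, derivative_poleSeries (hc q (Finset.mem_insert_self q s))]
      cases a q with
      | zero => simp
      | succ d =>
        rw [map_natCast, Nat.add_sub_cancel]
        ring
    rw [Finset.prod_insert hq, Finset.sum_insert hq, Derivation.leibniz, hpow,
      ih fun p hp => hc p (Finset.mem_insert_of_mem hp), smul_eq_mul, smul_eq_mul]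
    ring

/-- Compare coefficients in the logarithmic derivative identity; its minus sign cancels the one in
the coefficients `-c⁻¹ ^ j` of the pole series. This is the source of the recursion for the weights.
-/
theorem coeff_prod_poleSeries_pow_succ (s : Finset ι) (a : ι → ℕ) (c : ι → K)
    (hc : ∀ q ∈ s, c q ≠ 0) (r : ℕ) :
    ((r + 1 : ℕ) : K) * PowerSeries.coeff (r + 1) (∏ q ∈ s, poleSeries (c q) ^ a q) =
      ∑ j ∈ Finset.Icc 1 (r + 1), ∑ q ∈ s, (a q : K) * (c q)⁻¹ ^ j *
        PowerSeries.coeff (r + 1 - j) (∏ q ∈ s, poleSeries (c q) ^ a q) := by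
  have h := congrArg (PowerSeries.coeff r) (derivative_prod_poleSeries_pow s a c hc)
  rw [PowerSeries.coeff_derivative, map_neg, PowerSeries.coeff_mul,
    Finset.Nat.sum_antidiagonal_eq_sum_range_succ (fun p t => PowerSeries.coeff p
      (∑ q ∈ s, PowerSeries.C (a q : K) * poleSeries (c q)) *
        PowerSeries.coeff t (∏ q ∈ s, poleSeries (c q) ^ a q))] at h
  rw [mul_comm, Nat.cast_succ, h, ← Finset.sum_neg_distrib, ← Finset.Ico_succ_right_eq_Icc,
    Nat.succ_eq_succ, Finset.sum_Ico_eq_sum_range]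
  refine Finset.sum_congr rfl fun p _ => ?_
  rw [map_sum, Finset.sum_mul, ← Finset.sum_neg_distrib]
  refine Finset.sum_congr rfl fun q _ => ?_
  rw [PowerSeries.coeff_C_mul, poleSeries, PowerSeries.coeff_mk,
    show r + 1 - (1 + p) = r - p by omega, add_comm 1 p]
  ring

end PoleSeries

/-! ### Partial fractions -/

section PartialFractions

variable {K ι : Type*} [Field K] [Fintype ι] [DecidableEq ι]

/-- The expansion of `∏_{q ≠ i} (X + b q - b i) ^ (-a q)` at `0`. -/
noncomputable def cofactorSeries (a : ι → ℕ) (b : ι → K) (i : ι) : PowerSeries K :=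
  ∏ q ∈ Finset.univ.erase i, poleSeries (b i - b q) ^ a q

theorem X_pow_dvd_one_sub_trunc_cofactorSeries (a : ι → ℕ) {b : ι → K}
    (hb : ∀ i j, i ≠ j → b i ≠ b j) (i : ι) (N : ℕ) :
    (Polynomial.X : Polynomial K) ^ N ∣ 1 - PowerSeries.trunc N (cofactorSeries a b i) *
      ∏ q ∈ Finset.univ.erase i, (Polynomial.X - Polynomial.C (b i - b q)) ^ a q := by
  set Q : Polynomial K :=
    ∏ q ∈ Finset.univ.erase i, (Polynomial.X - Polynomial.C (b i - b q)) ^ a q with hQ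
  have hQ' : (Q : PowerSeries K) =
      ∏ q ∈ Finset.univ.erase i, (PowerSeries.X - PowerSeries.C (b i - b q)) ^ a q := by
    rw [hQ, ← Polynomial.coeToPowerSeries.ringHom_apply, map_prod]
    simp
  have hmul : cofactorSeries a b i * (Q : PowerSeries K) = 1 := by
    rw [hQ', cofactorSeries, ← Finset.prod_mul_distrib]
    refine Finset.prod_eq_one fun q hq => ?_
    rw [← mul_pow, poleSeries_mul (sub_ne_zero.2 (hb i q (Finset.ne_of_mem_erase hq).symm)),
      one_pow]
  rw [Polynomial.X_pow_dvd_iff]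
  intro d hd
  have h1 := congrArg (fun p : Polynomial K => p.coeff d)
    (PowerSeries.trunc_trunc_mul (n := N) (cofactorSeries a b i) (Q : PowerSeries K))
  simp only [PowerSeries.coeff_trunc, hd, if_true, hmul] at h1
  rw [Polynomial.coeff_sub, sub_eq_zero, ← Polynomial.coeff_coe, ← Polynomial.coeff_coe,
    Polynomial.coe_mul, h1, Polynomial.coe_one]

/-- Partial fraction decomposition of `∏ (X + b w) ^ (-a w)`, after clearing denominators. -/
theorem sum_trunc_cofactorSeries_mul_prod [Nonempty ι] {a : ι → ℕ} (ha : ∀ i, 0 < a i) {b : ι → K}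
    (hb : ∀ i j, i ≠ j → b i ≠ b j) :
    ∑ i, (PowerSeries.trunc (a i) (cofactorSeries a b i)).comp
        (Polynomial.X + Polynomial.C (b i)) *
      ∏ q ∈ Finset.univ.erase i, (Polynomial.X + Polynomial.C (b q)) ^ a q = 1 := by
  -- The difference of the two sides is divisible by each of the pairwise coprime `(X + b i) ^ a i`,
  -- hence by their product, whose degree `∑ a` exceeds its own. Modulo the `i`-th factor only the
  -- `i`-th summand survives, and it is `1` there by the choice of the truncated inverse.
  refine (sub_eq_zero.1 (Polynomial.eq_zero_of_dvd_of_degree_lt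
    (p := ∏ w, (Polynomial.X + Polynomial.C (b w)) ^ a w) ?_ ?_)).symm
  · refine Finset.prod_dvd_of_coprime (fun i _ j _ hij => ?_) fun i _ => ?_
    · have h := Polynomial.isCoprime_X_sub_C_of_isUnit_sub (a := -b i) (b := -b j)
        (by rw [isUnit_iff_ne_zero, neg_sub_neg]; exact sub_ne_zero.2 (hb j i hij.symm))
      simp only [map_neg, sub_neg_eq_add] at h
      exact h.pow
    · rw [← Finset.add_sum_erase _ _ (Finset.mem_univ i), ← sub_sub]
      refine dvd_sub ?_ (Finset.dvd_sum fun j hj => ?_)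
      · obtain ⟨S, hS⟩ := X_pow_dvd_one_sub_trunc_cofactorSeries a hb i (a i)
        have h := congrArg (fun p => p.comp (Polynomial.X + Polynomial.C (b i))) hS
        simp only [Polynomial.sub_comp, Polynomial.mul_comp, Polynomial.one_comp,
          Polynomial.prod_comp, Polynomial.pow_comp, Polynomial.X_comp, Polynomial.C_comp] at h
        refine ⟨_, (Eq.trans ?_ h)⟩
        congr 2
        refine Finset.prod_congr rfl fun q _ => ?_
        rw [map_sub]
        ring
      · refine Dvd.dvd.mul_left (Finset.dvd_prod_of_mem _ ?_) _
        exact Finset.mem_erase.2 ⟨(Finset.ne_of_mem_erase hj).symm, Finset.mem_univ i⟩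
  · have hdeg : ∀ s : Finset ι, (∏ w ∈ s, (Polynomial.X + Polynomial.C (b w)) ^ a w).degree =
        ((∑ w ∈ s, a w : ℕ) : WithBot ℕ) := by
      intro s
      rw [Polynomial.degree_prod, Nat.cast_sum]
      refine Finset.sum_congr rfl fun w _ => ?_
      rw [Polynomial.degree_pow, Polynomial.degree_X_add_C, nsmul_one]
    rw [hdeg]
    refine (Polynomial.degree_sub_le _ _).trans_lt (max_lt ?_ ?_)
    · rw [Polynomial.degree_one]
      obtain ⟨i⟩ := ‹Nonempty ι›
      exact_mod_cast (ha i).trans_le (Finset.single_le_sum (fun _ _ => Nat.zero_le _)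
        (Finset.mem_univ i))
    · refine (Polynomial.degree_sum_le _ _).trans_lt
        ((Finset.sup_lt_iff (WithBot.bot_lt_coe _)).2 fun i _ => ?_)
      rw [Polynomial.degree_mul, hdeg, ← Finset.add_sum_erase _ _ (Finset.mem_univ i),
        Nat.cast_add]
      refine WithBot.add_lt_add_right (WithBot.natCast_ne_bot _) ?_
      rw [Polynomial.degree_lt_iff_coeff_zero]
      intro d hd
      refine Polynomial.coeff_eq_zero_of_degree_lt ?_
      -- Substituting `X + b i` is a Taylor shift, so the degree stays below `a i`.
      rw [← Polynomial.taylor_apply, Polynomial.degree_taylor]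
      exact (PowerSeries.degree_trunc_lt _ _).trans_le (by exact_mod_cast hd)

/-- Partial fraction decomposition of `∏ (b w - z) ^ (-a w)`. -/
theorem prod_inv_pow_eq_sum_cofactorSeries {F : Type*} [Field F] [Algebra K F] [Nonempty ι]
    {a : ι → ℕ} (ha : ∀ i, 0 < a i) {b : ι → K} (hb : ∀ i j, i ≠ j → b i ≠ b j) {z : F}
    (hz : ∀ i, algebraMap K F (b i) - z ≠ 0) :
    ∏ w, ((algebraMap K F (b w) - z) ^ a w)⁻¹ =
      ∑ i, ∑ k ∈ Finset.Icc 1 (a i), algebraMap K F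
        (PowerSeries.coeff (a i - k) (cofactorSeries a b i)) *
          ((algebraMap K F (b i) - z) ^ k)⁻¹ := by
  have h := congrArg (Polynomial.aeval (-z)) (sum_trunc_cofactorSeries_mul_prod ha hb)
  simp only [map_sum, map_mul, map_prod, map_pow, map_add, map_one, Polynomial.aeval_comp,
    Polynomial.aeval_X, Polynomial.aeval_C, neg_add_eq_sub] at h
  rw [← mul_one (∏ w, _), ← h, Finset.mul_sum]
  refine Finset.sum_congr rfl fun i _ => ?_
  rw [← Finset.mul_prod_erase _ _ (Finset.mem_univ i), Polynomial.aeval_def,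
    PowerSeries.eval₂_trunc_eq_sum_range, Finset.prod_inv_distrib]
  have hne : ∏ q ∈ Finset.univ.erase i, (algebraMap K F (b q) - z) ^ a q ≠ 0 :=
    Finset.prod_ne_zero_iff.2 fun q _ => pow_ne_zero _ (hz q)
  rw [mul_comm (Finset.sum _ _), mul_assoc, inv_mul_cancel_left₀ hne, Finset.mul_sum]
  refine Finset.sum_nbij' (fun r => a i - r) (fun k => a i - k) ?_ ?_ ?_ ?_ ?_
  · intro r hr
    simp only [Finset.mem_Icc, Finset.mem_range] at hr ⊢
    omega
  · intro k hk
    simp only [Finset.mem_Icc, Finset.mem_range] at hk ⊢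
    omega
  · intro r hr
    simp only [Finset.mem_range] at hr
    omega
  · intro k hk
    simp only [Finset.mem_Icc] at hk
    omega
  · intro r hr
    rw [Finset.mem_range] at hr
    rw [Nat.sub_sub_self hr.le, mul_left_comm, pow_sub₀ _ (hz i) hr.le, mul_inv, inv_inv]

end PartialFractions

/-! ### The weights as Taylor coefficients -/

section Weights

variable {n : ℕ} {a : Fin (n + 1) → ℕ} {b : Fin (n + 1) → ℝ}

theorem prod_univ_succAbove_eq_prod_erase {M : Type*} [CommMonoid M] (i : Fin (n + 1))
    (g : Fin (n + 1) → M) : ∏ s : Fin n, g (i.succAbove s) = ∏ q ∈ Finset.univ.erase i, g q := by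
  rw [← Finset.compl_singleton, ← Fin.image_succAbove_univ,
    Finset.prod_image fun _ _ _ _ h => Fin.succAbove_right_injective h]

/-- Once the global sign is distributed as `(-1) ^ a q` over the `q ≠ i`, each factor of a chain's
summand is the coefficient of order `j_{s-1} - j_s` in a power of a pole series. -/
theorem Xi0_eq_coeff_cofactorSeries (ha : ∀ i, 0 < a i) (i : Fin (n + 1)) {k : ℕ}
    (hk : k ≤ a i) :
    Xi0 a b i k = (∏ w, b w ^ a w) / b i ^ k *
      PowerSeries.coeff (a i - k) (cofactorSeries a b i) := by
  have hsign : (-1 : ℝ) ^ ((∑ q, a q) - a i) = ∏ s : Fin n, (-1 : ℝ) ^ a (i.succAbove s) := by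
    rw [Fin.sum_univ_succAbove a i, Nat.add_sub_cancel_left, Finset.prod_pow_eq_pow_sum]
  rw [cofactorSeries, ← prod_univ_succAbove_eq_prod_erase i fun q => poleSeries (b i - b q) ^ a q,
    ← sum_chains_prod_coeff hk, Finset.mul_sum, Xi0]
  refine Finset.sum_congr rfl fun j hj => ?_
  rw [hsign, mul_comm (Finset.prod _ _) (_ / _), mul_assoc, ← Finset.prod_mul_distrib]
  congr 1
  refine Finset.prod_congr rfl fun s _ => ?_
  have hjs : j s.succ ≤ j s.castSucc := (mem_chains.1 hj).1 s.castSucc_le_succ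
  rw [coeff_poleSeries_pow (ha _), ← Nat.sub_add_comm hjs, inv_pow,
    ← zpow_natCast (b i - _), ← zpow_neg]
  congr 3
  omega

theorem Xi0_self (ha : ∀ i, 0 < a i) (i : Fin (n + 1)) :
    Xi0 a b i (a i) = (∏ w, b w ^ a w) / b i ^ a i *
      ∏ j ∈ Finset.univ.erase i, (b j - b i) ^ (-(a j : ℤ)) := by
  rw [Xi0_eq_coeff_cofactorSeries ha i le_rfl, Nat.sub_self,
    PowerSeries.coeff_zero_eq_constantCoeff_apply, cofactorSeries, map_prod]
  congr 1
  refine Finset.prod_congr rfl fun q _ => ?_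
  rw [map_pow, ← PowerSeries.coeff_zero_eq_constantCoeff_apply, poleSeries, PowerSeries.coeff_mk,
    zero_add, pow_one, ← inv_neg, neg_sub, zpow_neg, zpow_natCast, inv_pow]

theorem Xi0_recursion (ha : ∀ i, 0 < a i) (hb0 : ∀ i, b i ≠ 0) (hb : ∀ i j, i ≠ j → b i ≠ b j)
    (i : Fin (n + 1)) {k : ℕ} (hk1 : 1 ≤ k) (hk : k ≤ a i) :
    Xi0 a b i (a i - k) = 1 / (k : ℝ) * ∑ j ∈ Finset.Icc 1 k, ∑ q ∈ Finset.univ.erase i,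
      (a q : ℝ) * b i ^ j * (b i - b q) ^ (-(j : ℤ)) * Xi0 a b i (a i - k + j) := by
  obtain ⟨r, rfl⟩ : ∃ r, k = r + 1 := ⟨k - 1, by omega⟩
  have h := coeff_prod_poleSeries_pow_succ (Finset.univ.erase i) a (fun q => b i - b q)
    (fun q hq => sub_ne_zero.2 (hb i q (Finset.ne_of_mem_erase hq).symm)) r
  change _ * PowerSeries.coeff (r + 1) (cofactorSeries a b i) = ∑ j ∈ _, ∑ q ∈ _, _ *
    PowerSeries.coeff (r + 1 - j) (cofactorSeries a b i) at h
  have hr : ((r + 1 : ℕ) : ℝ) ≠ 0 := Nat.cast_ne_zero.2 (Nat.succ_ne_zero r)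
  rw [one_div, eq_inv_mul_iff_mul_eq₀ hr, Xi0_eq_coeff_cofactorSeries ha i (Nat.sub_le _ _),
    Nat.sub_sub_self hk, mul_left_comm, h, Finset.mul_sum]
  refine Finset.sum_congr rfl fun j hj => ?_
  rw [Finset.mem_Icc] at hj
  rw [Finset.mul_sum]
  refine Finset.sum_congr rfl fun q _ => ?_
  rw [Xi0_eq_coeff_cofactorSeries ha i (by omega),
    show a i - (a i - (r + 1) + j) = r + 1 - j by omega, zpow_neg, zpow_natCast, inv_pow, pow_add]
  have := pow_ne_zero j (hb0 i)
  field_simp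

end Weights

/-! ### Laplace transform of monomials at complex arguments -/

section Laplace

theorem integrableOn_pow_mul_cexp_neg_mul (n : ℕ) {c : ℂ} (hc : 0 < c.re) :
    IntegrableOn (fun x : ℝ => (x : ℂ) ^ n * Complex.exp (-c * x)) (Set.Ioi 0) := by
  refine (integrable_norm_iff (Continuous.aestronglyMeasurable (by fun_prop))).1 ?_
  have h := integrableOn_rpow_mul_exp_neg_mul_rpow (s := n) (p := 1)
    (by have := n.cast_nonneg (α := ℝ); linarith) one_pos hc
  refine IntegrableOn.congr_fun h (fun x hx => ?_) measurableSet_Ioi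
  rw [Set.mem_Ioi] at hx
  simp [Complex.norm_exp, abs_of_pos hx]

theorem tendsto_pow_mul_cexp_neg_mul_atTop (n : ℕ) {c : ℂ} (hc : 0 < c.re) :
    Filter.Tendsto (fun x : ℝ => (x : ℂ) ^ n * Complex.exp (-c * x)) Filter.atTop (nhds 0) := by
  rw [tendsto_zero_iff_norm_tendsto_zero]
  refine (tendsto_rpow_mul_exp_neg_mul_atTop_nhds_zero n c.re hc).congr' ?_
  filter_upwards [Filter.eventually_gt_atTop 0] with x hx
  simp [Complex.norm_exp, abs_of_pos hx]

theorem integral_pow_mul_cexp_neg_mul_Ioi (n : ℕ) {c : ℂ} (hc : 0 < c.re) :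
    ∫ x : ℝ in Set.Ioi 0, (x : ℂ) ^ n * Complex.exp (-c * x) = (n ! : ℂ) / c ^ (n + 1) := by
  have hc0 : c ≠ 0 := by
    rintro rfl
    simp at hc
  induction n with
  | zero =>
    have h := integral_exp_mul_complex_Ioi (a := -c) (by simpa using hc) 0
    simpa [neg_div_neg_eq] using h
  | succ n ih =>
    have hi := integrableOn_pow_mul_cexp_neg_mul n hc
    have hi' := integrableOn_pow_mul_cexp_neg_mul (n + 1) hc
    have hderiv : ∀ x ∈ Set.Ici (0 : ℝ),
        HasDerivAt (fun x : ℝ => (x : ℂ) ^ (n + 1) * Complex.exp (-c * x))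
          ((n + 1 : ℂ) * ((x : ℂ) ^ n * Complex.exp (-c * x)) -
            c * ((x : ℂ) ^ (n + 1) * Complex.exp (-c * x))) x := by
      intro x _
      have hx : HasDerivAt (fun x : ℝ => (x : ℂ)) 1 x := Complex.ofRealCLM.hasDerivAt
      have h := (hx.fun_pow (n + 1)).fun_mul (hx.const_mul (-c)).cexp
      refine h.congr_deriv ?_
      push_cast [Nat.add_sub_cancel]
      ring
    -- Integration by parts: the boundary term vanishes at `0` because the exponent is `n + 1`, and
    -- at infinity by decay.
    have h := integral_Ioi_of_hasDerivAt_of_tendsto' hderiv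
      ((hi.const_mul _).sub (hi'.const_mul _)) (tendsto_pow_mul_cexp_neg_mul_atTop (n + 1) hc)
    rw [integral_sub (hi.const_mul _) (hi'.const_mul _), integral_const_mul, integral_const_mul,
      ih] at h
    simp only [Complex.ofReal_zero, ne_eq, Nat.add_eq_zero_iff, one_ne_zero, and_false,
      not_false_eq_true, zero_pow, zero_mul, sub_zero] at h
    rw [eq_div_iff_mul_eq (pow_ne_zero _ hc0), pow_succ' c, ← mul_assoc, mul_comm _ c,
      ← sub_eq_zero.1 h, mul_assoc, div_mul_cancel₀ _ (pow_ne_zero _ hc0)]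
    push_cast [Nat.factorial_succ]
    rfl

end Laplace

/-! ### The Pearson density and its characteristic function -/

section Pearson

theorem pearsonPDF_nonneg {a : ℝ} (ha : 0 < a) (b m x : ℝ) : 0 ≤ pearsonPDF a b m x := by
  unfold pearsonPDF
  split_ifs with h
  · have := Real.Gamma_pos_of_pos ha
    positivity
  · exact le_rfl

theorem measurable_pearsonPDF (a b m : ℝ) : Measurable (pearsonPDF a b m) := by
  refine Measurable.ite (measurableSet_lt measurable_const (by fun_prop)) (by fun_prop)
    measurable_const

theorem continuousOn_pearsonPDF (a b m : ℝ) :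
    ContinuousOn (pearsonPDF a b m) {x | 0 < b * (x - m)} := by
  refine ContinuousOn.congr (f := fun x =>
    |b| / Real.Gamma a * (b * (x - m)) ^ (a - 1) * Real.exp (-(b * (x - m)))) ?_
    fun x hx => if_pos hx
  refine ContinuousOn.mul (ContinuousOn.mul continuousOn_const ?_) (by fun_prop)
  exact ContinuousOn.rpow_const (by fun_prop) fun x hx => Or.inl (ne_of_gt hx)

/-- In the variable `y = b (x - m)` the support is always `(0, ∞)`, so an affine change of variables
treats both signs of `b` at once. -/
theorem pearsonPDF_eq_indicator_comp (a b m x : ℝ) :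
    pearsonPDF a b m x = (Set.Ioi (0 : ℝ)).indicator
      (fun y => |b| / Real.Gamma a * (Real.exp (-y) * y ^ (a - 1))) (b * (x - m)) := by
  simp only [pearsonPDF, Set.indicator_apply, Set.mem_Ioi]
  split_ifs <;> ring

theorem integrable_pearsonPDF {a b : ℝ} (ha : 0 < a) (hb : b ≠ 0) (m : ℝ) :
    Integrable (pearsonPDF a b m) := by
  have h := (integrable_indicator_iff measurableSet_Ioi).2
    ((Real.GammaIntegral_convergent ha).const_mul (|b| / Real.Gamma a))
  exact ((h.comp_mul_left' hb).comp_sub_right m).congr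
    (Filter.Eventually.of_forall fun x => (pearsonPDF_eq_indicator_comp a b m x).symm)

/-- The characteristic function of the Pearson type III distribution. -/
theorem integral_cexp_mul_pearsonPDF {k : ℕ} (hk : 0 < k) {b : ℝ} (hb : b ≠ 0) (m t : ℝ) :
    ∫ x : ℝ, Complex.exp (t * x * Complex.I) * (pearsonPDF k b m x : ℂ) =
      Complex.exp (t * m * Complex.I) * (b / (b - t * Complex.I)) ^ k := by
  obtain ⟨d, rfl⟩ : ∃ d, k = d + 1 := ⟨k - 1, by omega⟩
  have hbC : (b : ℂ) ≠ 0 := Complex.ofReal_ne_zero.2 hb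
  -- In the variable `y`, the factors `e^{-y}` and `e^{it(x - m)}` combine to `e^{-cy}`, with `Re c
  -- = 1` for either sign of `b`.
  set c : ℂ := 1 - t / b * Complex.I with hc
  have hcre : c.re = 1 := by
    rw [hc, ← Complex.ofReal_div]
    simp
  have hcb : (b : ℂ) - t * Complex.I = b * c := by
    rw [hc]
    field_simp
  have hc0 : c ≠ 0 := by
    intro h
    simp [h] at hcre
  let G : ℝ → ℂ := (Set.Ioi (0 : ℝ)).indicator fun y =>
    (|b| / d ! * Complex.exp (t * m * Complex.I)) * ((y : ℂ) ^ d * Complex.exp (-c * y))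
  have hG : ∀ x : ℝ, Complex.exp (t * x * Complex.I) * (pearsonPDF (d + 1 : ℕ) b m x : ℂ) =
      G (b * (x - m)) := by
    intro x
    rw [pearsonPDF_eq_indicator_comp]
    simp only [G, Set.indicator_apply]
    split_ifs with hy
    · have he : Complex.exp (-c * (b * (x - m) : ℝ)) =
          Complex.exp (-(b * (x - m) : ℝ)) * Complex.exp (t * (x - m) * Complex.I) := by
        rw [← Complex.exp_add, hc]
        congr 1
        push_cast
        field_simp
        ring
      have he' : Complex.exp (t * x * Complex.I) =
          Complex.exp (t * m * Complex.I) * Complex.exp (t * (x - m) * Complex.I) := by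
        rw [← Complex.exp_add]
        congr 1
        ring
      rw [he, he', Nat.cast_succ, add_sub_cancel_right, Real.rpow_natCast,
        Real.Gamma_nat_eq_factorial]
      push_cast
      ring
    · simp
  simp_rw [hG]
  rw [integral_sub_right_eq_self (fun x => G (b * x)) m, Measure.integral_comp_mul_left,
    integral_indicator measurableSet_Ioi, integral_const_mul,
    integral_pow_mul_cexp_neg_mul_Ioi d (by rw [hcre]; exact one_pos), hcb, abs_inv,
    Complex.real_smul]
  have hd : (d ! : ℂ) ≠ 0 := Nat.cast_ne_zero.2 (Nat.factorial_ne_zero d)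
  have hab : ((|b| : ℝ) : ℂ) ≠ 0 := Complex.ofReal_ne_zero.2 (abs_ne_zero.2 hb)
  rw [div_mul_cancel_left₀ hbC, inv_pow]
  push_cast
  field_simp

end Pearson

/-! ### From characteristic functions to densities -/

section Uniqueness

theorem charFun_withDensity_ofReal {g : ℝ → ℝ} (hg : Measurable g) (t : ℝ) :
    charFun (volume.withDensity fun x => ENNReal.ofReal (g x)) t =
      ∫ x : ℝ, Complex.exp (t * x * Complex.I) * ((max (g x) 0 : ℝ) : ℂ) := by
  rw [charFun_apply_real, integral_withDensity_eq_integral_toReal_smul (by fun_prop)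
    (Filter.Eventually.of_forall fun _ => ENNReal.ofReal_lt_top)]
  refine integral_congr_ae (Filter.Eventually.of_forall fun x => ?_)
  simp only [ENNReal.toReal_ofReal', Complex.real_smul]
  ring

theorem integrable_cexp_mul {g : ℝ → ℝ} (hg : Integrable g) (t : ℝ) :
    Integrable fun x : ℝ => Complex.exp (t * x * Complex.I) * (g x : ℂ) := by
  refine hg.ofReal.bdd_mul (c := 1) (Continuous.aestronglyMeasurable (by fun_prop))
    (Filter.Eventually.of_forall fun x => ?_)
  rw [← Complex.ofReal_mul, Complex.norm_exp_ofReal_mul_I]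

/-- A finite measure whose characteristic function is the Fourier transform of the integrable
function `g` has density `g`, and `g` is nonnegative almost everywhere. -/
theorem eq_withDensity_of_charFun_eq {μ : Measure ℝ} [IsFiniteMeasure μ] {g : ℝ → ℝ}
    (hgm : Measurable g) (hg : Integrable g)
    (h : ∀ t : ℝ, charFun μ t = ∫ x : ℝ, Complex.exp (t * x * Complex.I) * (g x : ℂ)) :
    μ = (volume.withDensity fun x => ENNReal.ofReal (g x)) ∧ volume {x | g x < 0} = 0 := by
  have := isFiniteMeasure_withDensity_ofReal hg.2
  have := isFiniteMeasure_withDensity_ofReal hg.neg.2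
  -- Moving the negative part of `g` to the left leaves finite positive measures on both sides, to
  -- which uniqueness of characteristic functions applies.
  have key : μ + (volume.withDensity fun x => ENNReal.ofReal ((-g) x)) =
      volume.withDensity fun x => ENNReal.ofReal (g x) := by
    refine Measure.ext_of_charFun (funext fun t => ?_)
    have hadd : charFun (μ + volume.withDensity fun x => ENNReal.ofReal ((-g) x)) t =
        charFun μ t + charFun (volume.withDensity fun x => ENNReal.ofReal ((-g) x)) t := by
      have h_int : ∀ (ν : Measure ℝ) [IsFiniteMeasure ν],
          Integrable (fun x : ℝ => Complex.exp (t * x * Complex.I)) ν := by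
        intro ν _
        refine Integrable.of_bound (Continuous.aestronglyMeasurable (by fun_prop)) 1
          (Filter.Eventually.of_forall fun x => ?_)
        rw [← Complex.ofReal_mul, Complex.norm_exp_ofReal_mul_I]
      simp only [charFun_apply_real]
      exact integral_add_measure (h_int _) (h_int _)
    rw [hadd, h, charFun_withDensity_ofReal hgm, charFun_withDensity_ofReal hgm.neg,
      ← integral_add (integrable_cexp_mul hg t) (integrable_cexp_mul hg.neg.pos_part t)]
    refine integral_congr_ae (Filter.Eventually.of_forall fun x => ?_)
    simp only [← mul_add, ← Complex.ofReal_add, Pi.neg_apply]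
    congr 2
    rcases le_total 0 (g x) with hx | hx
    · rw [max_eq_right (by linarith), max_eq_left hx, add_zero]
    · rw [max_eq_left (by linarith), max_eq_right hx, add_neg_cancel]
  have hs : MeasurableSet {x | g x < 0} := measurableSet_lt hgm measurable_const
  have hneg : volume {x | g x < 0} = 0 := by
    -- The positive part has no mass on `{g < 0}`; by `key` neither has the negative part, which is
    -- strictly positive there.
    have h1 : (volume.withDensity fun x => ENNReal.ofReal (g x)) {x | g x < 0} = 0 := by
      rw [withDensity_apply _ hs]
      refine (setLIntegral_congr_fun hs fun x hx => ?_).trans lintegral_zero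
      exact ENNReal.ofReal_of_nonpos (le_of_lt hx)
    rw [← key, Measure.add_apply, add_eq_zero,
      withDensity_apply_eq_zero (by exact hgm.neg.ennreal_ofReal)] at h1
    convert h1.2 using 2
    ext x
    simp
  refine ⟨?_, hneg⟩
  rw [← key]
  have hz : (volume.withDensity fun x => ENNReal.ofReal ((-g) x)) = 0 := by
    refine withDensity_eq_zero_iff (by exact hgm.neg.ennreal_ofReal.aemeasurable) |>.2 ?_
    have : ∀ᵐ x, ¬ g x < 0 := by
      rw [ae_iff]
      simpa using hneg
    filter_upwards [this] with x hx
    exact ENNReal.ofReal_of_nonpos (by simpa using hx)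
  rw [hz, add_zero]

/-- Openness upgrades almost everywhere nonnegativity to every point, since an open Lebesgue-null
set is empty. -/
theorem HasRealPDF.of_charFun_eq {Ω : Type*} [MeasurableSpace Ω] {P : Measure Ω}
    [IsFiniteMeasure P] {X : Ω → ℝ} (hX : AEMeasurable X P) {g : ℝ → ℝ} (hgm : Measurable g)
    (hg : Integrable g) (hopen : IsOpen {x | g x < 0})
    (h : ∀ t : ℝ, charFun (P.map X) t =
      ∫ x : ℝ, Complex.exp (t * x * Complex.I) * (g x : ℂ)) :
    HasRealPDF X g P := by
  obtain ⟨hlaw, hneg⟩ := eq_withDensity_of_charFun_eq hgm hg h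
  refine ⟨hgm, fun x => not_lt.1 fun hx => ?_, hX, hlaw⟩
  exact (Set.mem_empty_iff_false x).1 (hopen.eq_empty_of_measure_zero hneg ▸ hx)

theorem HasRealPDF.charFun_eq {Ω : Type*} [MeasurableSpace Ω] {P : Measure Ω} {X : Ω → ℝ}
    {g : ℝ → ℝ} (h : HasRealPDF X g P) (t : ℝ) :
    charFun (P.map X) t = ∫ x : ℝ, Complex.exp (t * x * Complex.I) * (g x : ℂ) := by
  rw [h.2.2.map_eq, charFun_withDensity_ofReal h.1]
  simp_rw [max_eq_left (h.2.1 _)]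

end Uniqueness

/-! ### Sums of independent Pearson variables -/

section Sums

/-- As the `b i` have one sign and `m` is common, all terms live on the same open half-line: the sum
is continuous on it and zero off it. -/
theorem isOpen_setOf_sum_pearsonPDF_neg {ι : Type*} [Fintype ι] {κ : Type*} (s : ι → Finset κ)
    (w a : ι → κ → ℝ) {b : ι → ℝ} (hb : (∀ i, 0 < b i) ∨ (∀ i, b i < 0)) (m : ℝ) :
    IsOpen {x | ∑ i, ∑ k ∈ s i, w i k * pearsonPDF (a i k) (b i) m x < 0} := by
  obtain ⟨U, hU, hbU⟩ : ∃ U : Set ℝ, IsOpen U ∧ ∀ i, {x | 0 < b i * (x - m)} = U := by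
    rcases hb with hb | hb
    · refine ⟨Set.Ioi m, isOpen_Ioi, fun i => Set.ext fun x => ?_⟩
      rw [Set.mem_ofPred_eq, mul_pos_iff_of_pos_left (hb i), sub_pos, Set.mem_Ioi]
    · refine ⟨Set.Iio m, isOpen_Iio, fun i => Set.ext fun x => ?_⟩
      rw [Set.mem_ofPred_eq, ← neg_mul_neg, mul_pos_iff_of_pos_left (neg_pos.2 (hb i)),
        neg_sub, sub_pos, Set.mem_Iio]
  have hcont : ContinuousOn (fun x => ∑ i, ∑ k ∈ s i, w i k * pearsonPDF (a i k) (b i) m x) U :=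
    continuousOn_finsetSum _ fun i _ => continuousOn_finsetSum _ fun k _ =>
      continuousOn_const.mul (hbU i ▸ continuousOn_pearsonPDF (a i k) (b i) m)
  convert hcont.isOpen_inter_preimage hU (isOpen_Iio (a := (0 : ℝ))) using 1
  refine (Set.inter_eq_right.2 fun x hx => ?_).symm
  by_contra hxU
  rw [Set.mem_ofPred_eq] at hx
  refine not_lt.2 (Finset.sum_nonneg fun i _ => Finset.sum_nonneg fun k _ => ?_) hx
  have hi : ¬ 0 < b i * (x - m) := by rwa [← hbU i, Set.mem_ofPred_eq] at hxU
  rw [pearsonPDF, if_neg hi, mul_zero]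

theorem charFun_map_sum_pearson {Ω ι : Type*} [MeasurableSpace Ω] {P : Measure Ω}
    [Fintype ι] {X : ι → Ω → ℝ} {a : ι → ℕ} {b m : ι → ℝ} (ha : ∀ i, 0 < a i)
    (hX : ∀ i, IsPearson (X i) (a i) (b i) (m i) P) (hind : iIndepFun X P) (t : ℝ) :
    charFun (P.map fun ω => ∑ i, X i ω) t =
      Complex.exp (t * (∑ i, m i : ℝ) * Complex.I) *
        ∏ i, ((b i : ℂ) / (b i - t * Complex.I)) ^ a i := by
  rw [hind.charFun_map_fun_sum_eq_prod fun i => (hX i).2.2.2.2.aemeasurable, Finset.prod_apply,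
    Complex.ofReal_sum, Finset.mul_sum, Finset.sum_mul, Complex.exp_sum,
    ← Finset.prod_mul_distrib]
  refine Finset.prod_congr rfl fun i _ => ?_
  rw [(hX i).2.2.charFun_eq, integral_cexp_mul_pearsonPDF (ha i) (hX i).2.1]

end Sums

theorem prod_div_pow_eq_sum_Xi0 {n : ℕ} {a : Fin (n + 1) → ℕ} {b : Fin (n + 1) → ℝ}
    (ha : ∀ i, 0 < a i) (hb0 : ∀ i, b i ≠ 0) (hb : ∀ i j, i ≠ j → b i ≠ b j) {z : ℂ}
    (hz : ∀ i, (b i : ℂ) - z ≠ 0) :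
    ∏ i, ((b i : ℂ) / (b i - z)) ^ a i =
      ∑ i, ∑ k ∈ Finset.Icc 1 (a i), (Xi0 a b i k : ℂ) * ((b i : ℂ) / (b i - z)) ^ k := by
  have h := prod_inv_pow_eq_sum_cofactorSeries (F := ℂ) ha hb hz
  simp only [Complex.coe_algebraMap] at h
  simp_rw [div_pow, div_eq_mul_inv]
  rw [Finset.prod_mul_distrib, h, Finset.mul_sum]
  refine Finset.sum_congr rfl fun i _ => ?_
  rw [Finset.mul_sum]
  refine Finset.sum_congr rfl fun k hk => ?_
  rw [Xi0_eq_coeff_cofactorSeries ha i (Finset.mem_Icc.1 hk).2]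
  have hbk : (b i : ℂ) ^ k ≠ 0 := pow_ne_zero k (Complex.ofReal_ne_zero.2 (hb0 i))
  push_cast
  field_simp

theorem mainTheorem1 {Ω : Type*} [MeasurableSpace Ω] (P : Measure Ω) [IsProbabilityMeasure P]
    (n : ℕ) (X : Fin (n + 1) → Ω → ℝ) (a : Fin (n + 1) → ℕ) (b m : Fin (n + 1) → ℝ)
    (ha : ∀ i, 0 < a i) (hb : (∀ i, 0 < b i) ∨ (∀ i, b i < 0))
    (hX : ∀ i, IsPearson (X i) (a i) (b i) (m i) P) (hind : iIndepFun X P) :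
    (∀ β : ℝ, (∀ i, b i = β) →
      IsPearson (fun ω => ∑ i, X i ω) ((∑ i, a i : ℕ) : ℝ) β (∑ i, m i) P) ∧
    ((∀ i j, i ≠ j → b i ≠ b j) →
      HasRealPDF (fun ω => ∑ i, X i ω)
        (fun x => ∑ i, ∑ k ∈ Finset.Icc 1 (a i),
          Xi0 a b i k * pearsonPDF (k : ℝ) (b i) (∑ q, m q) x) P ∧
      (∀ i, Xi0 a b i (a i) =
        (∏ w, b w ^ a w) / b i ^ a i *
          ∏ j ∈ Finset.univ.erase i, (b j - b i) ^ (-(a j : ℤ))) ∧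
      (∀ i, ∀ k : ℕ, 1 ≤ k → k < a i →
        Xi0 a b i (a i - k) =
          1 / (k : ℝ) * ∑ j ∈ Finset.Icc 1 k, ∑ q ∈ Finset.univ.erase i,
            (a q : ℝ) * b i ^ j * (b i - b q) ^ (-(j : ℤ)) * Xi0 a b i (a i - k + j))) := by
  have hb0 : ∀ i, b i ≠ 0 := fun i => (hX i).2.1
  have hmeas : AEMeasurable (fun ω => ∑ i, X i ω) P :=
    Finset.aemeasurable_fun_sum _ fun i _ => (hX i).2.2.2.2.aemeasurable
  refine ⟨fun β hβ => ?_, fun hne => ⟨?_, Xi0_self ha, fun i k hk1 hk =>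
    Xi0_recursion ha hb0 hne i hk1 hk.le⟩⟩
  · have hsa : 0 < ∑ i, a i := (ha 0).trans_le
      (Finset.single_le_sum (fun _ _ => Nat.zero_le _) (Finset.mem_univ 0))
    have hsa' : (0 : ℝ) < (∑ i, a i : ℕ) := Nat.cast_pos.2 hsa
    have hβ0 : β ≠ 0 := hβ 0 ▸ hb0 0
    refine ⟨hsa', hβ0, HasRealPDF.of_charFun_eq hmeas (measurable_pearsonPDF _ _ _)
      (integrable_pearsonPDF hsa' hβ0 _) ?_ fun t => ?_⟩
    · convert isOpen_empty
      exact Set.eq_empty_of_forall_notMem fun x hx =>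
        not_lt.2 (pearsonPDF_nonneg hsa' _ _ x) hx
    · rw [charFun_map_sum_pearson ha hX hind, integral_cexp_mul_pearsonPDF hsa hβ0]
      simp_rw [hβ, Finset.prod_pow_eq_pow_sum]
  · have h_int : ∀ i, ∀ k ∈ Finset.Icc 1 (a i),
        Integrable (pearsonPDF (k : ℝ) (b i) (∑ q, m q)) := fun i k hk =>
      integrable_pearsonPDF (Nat.cast_pos.2 (Finset.mem_Icc.1 hk).1) (hb0 i) _
    refine HasRealPDF.of_charFun_eq hmeas ?_ ?_
      (isOpen_setOf_sum_pearsonPDF_neg _ (Xi0 a b) (fun _ k => (k : ℝ)) hb _) fun t => ?_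
    · exact Finset.measurable_fun_sum _ fun i _ => Finset.measurable_fun_sum _ fun k _ =>
        (measurable_pearsonPDF _ _ _).const_mul _
    · exact integrable_finsetSum _ fun i _ => integrable_finsetSum _ fun k hk =>
        (h_int i k hk).const_mul _
    -- The poles `b i` are real and nonzero, so the imaginary axis avoids them.
    · have hz : ∀ i, (b i : ℂ) - t * Complex.I ≠ 0 := by
        intro i h
        have := congrArg Complex.re h
        simp [hb0 i] at this
      rw [charFun_map_sum_pearson ha hX hind, prod_div_pow_eq_sum_Xi0 ha hb0 hne hz]
      push_cast
      simp_rw [Finset.mul_sum, mul_left_comm _ (Xi0 a b _ _ : ℂ)]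
      have h_int_exp : ∀ i, ∀ k ∈ Finset.Icc 1 (a i), Integrable fun x : ℝ =>
          (Xi0 a b i k : ℂ) * (Complex.exp (t * x * Complex.I) *
            (pearsonPDF (k : ℝ) (b i) (∑ q, m q) x : ℂ)) := fun i k hk =>
        (integrable_cexp_mul (h_int i k hk) t).const_mul _
      rw [integral_finsetSum _ fun i _ => integrable_finsetSum _ (h_int_exp i)]
      refine Finset.sum_congr rfl fun i _ => ?_
      rw [integral_finsetSum _ (h_int_exp i)]
      refine Finset.sum_congr rfl fun k hk => ?_
      rw [integral_const_mul, integral_cexp_mul_pearsonPDF (Finset.mem_Icc.1 hk).1 (hb0 i),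
        Complex.ofReal_sum, Finset.mul_sum]
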